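/- Let $\alpha$ be an ordinal and let $d>1$ be an integer. Let $X_{\alpha,d}=\omega^{\alpha+1}\cdot d+1$ with the order topology, and let $\mathrm H_{\alpha,d}=\mathrm{Homeo}(X_{\alpha,d})$ be its group of self-homeomorphisms, equipped with the compact-open topology. Let $M_{\alpha,d}=\{\omega^{\alpha+1}\cdot k : 1\le k\le d\}$ be the set of points of $X_{\alpha,d}$ of maximal Cantor--Bendixson rank, and let $N_{\alpha,d}$ be the set of points of next-to-maximal rank, that is, $N_{\alpha,d}=\{\omega^{\alpha+1}\cdot k+\omega^{\alpha}\cdot \ell : 0\le k<d,\ \ell\ge 1\}$, together with the point $0$ if $\alpha=0$. Let $\mathrm{PH}_{\alpha,d}\le \mathrm H_{\alpha,d}$ be the subgroup of homeomorphisms fixing every point of $M_{\alpha,d}$, let $\mathrm F_{\alpha,d}\le\mathrm H_{\alpha,d}$ be the subgroup of homeomorphisms inducing a finite permutation of $N_{\alpha,d}$ (i.e. moving only finitely many points of $N_{\alpha,d}$), and let $\overline{\mathrm F}_{\alpha,d}$ be the closure of $\mathrm F_{\alpha,d}$ in $\mathrm H_{\alpha,d}$. Then $\overline{\mathrm F}_{\alpha,d}\le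 \mathrm{PH}_{\alpha,d}$, and for suitable actions defining the semi-direct products there are group isomorphisms $$\mathrm{PH}_{\alpha,d}\cong \overline{\mathrm F}_{\alpha,d}\rtimes \mathbb Z^{d-1},\qquad \mathrm H_{\alpha,d}\cong \mathrm{PH}_{\alpha,d}\rtimes \mathrm{Sym}(d),$$ which restrict to the inclusions on the normal factors $\overline{\mathrm F}_{\alpha,d}$ and $\mathrm{PH}_{\alpha,d}$, respectively. In particular, $$\mathrm H_{\alpha,d}\cong(\overline{\mathrm F}_{\alpha,d}\rtimes\mathbb Z^{d-1})\rtimes\mathrm{Sym}(d),$$ by an isomorphism that restricts on the normal factor $\overline{\mathrm F}_{\alpha,d}\rtimes\mathbb Z^{d-1}$ to the first isomorphism above, onto $\mathrm{PH}_{\alpha,d}$. -/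

import Mathlib

universe u

open Ordinal

namespace OrdinalHomeo

section Topology

variable {X : Type*} [TopologicalSpace X]

/-- The compact-open topology on the group of self-homeomorphisms of `X`, i.e. the subspace
topology from the space `C(X, X)` of continuous maps with the compact-open topology. -/
instance compactOpen : TopologicalSpace (X ≃ₜ X) :=
  TopologicalSpace.induced (fun h => (⟨h, h.continuous⟩ : C(X, X))) inferInstance

/-- The homeomorphism group of a compact Hausdorff space is a topological group. -/
instance isTopologicalGroup [CompactSpace X] [T2Space X] : IsTopologicalGroup (X ≃ₜ X) where
  continuous_mul := by
    have hi : Continuous fun h : X ≃ₜ X => (⟨h, h.continuous⟩ : C(X, X)) :=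
      continuous_induced_dom
    refine continuous_induced_rng.2 ?_
    exact (hi.comp continuous_fst).compCM (hi.comp continuous_snd)
  continuous_inv := by
    have hi : Continuous fun h : X ≃ₜ X => (⟨h, h.continuous⟩ : C(X, X)) :=
      continuous_induced_dom
    refine continuous_induced_rng.2 (ContinuousMap.continuous_compactOpen.2 ?_)
    intro K hK U hU
    have hK' : IsOpen Kᶜ := hK.isClosed.isOpen_compl
    have hU' : IsCompact Uᶜ := hU.isClosed_compl.isCompact
    convert (ContinuousMap.isOpen_setOfPred_mapsTo hU' hK').preimage hi using 1
    ext h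
    constructor
    · intro H x hx hxK
      apply hx
      have := H hxK
      simpa using this
    · intro H x hx
      by_contra hc
      have := H hc
      apply this
      simpa using hx

end Topology

/-- The ordinal `ω ^ (α + 1) * d + 1`, as the set of all smaller ordinals. Its topology is the
order topology (an initial segment of the ordinals carries the subspace topology). -/
abbrev X (α : Ordinal.{u}) (d : ℕ) : Type (u + 1) :=
  Set.Iio (ω ^ (α + 1) * (d : Ordinal.{u}) + 1)

instance (α : Ordinal.{u}) (d : ℕ) : OrderTopology (X α d) :=
  orderTopology_of_ordConnected

instance (α : Ordinal.{u}) (d : ℕ) : CompactSpace (X α d) := by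
  have h : Set.Iio (ω ^ (α + 1) * (d : Ordinal.{u}) + 1)
      = Set.Icc 0 (ω ^ (α + 1) * (d : Ordinal.{u})) := by
    ext x
    simp [Order.lt_add_one_iff]
  exact isCompact_iff_compactSpace.1 (h ▸ isCompact_Icc)

/-- The group of all homeomorphisms of `ω ^ (α + 1) * d + 1`, under composition. -/
abbrev H (α : Ordinal.{u}) (d : ℕ) : Type (u + 1) := X α d ≃ₜ X α d

/-- The points of maximal rank: `ω ^ (α + 1) * k` for `1 ≤ k ≤ d`. -/
def M (α : Ordinal.{u}) (d : ℕ) : Set (X α d) :=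
  {x | ∃ k : ℕ, 1 ≤ k ∧ k ≤ d ∧ (x : Ordinal.{u}) = ω ^ (α + 1) * (k : Ordinal.{u})}

/-- The points of next-to-maximal rank: `ω ^ (α + 1) * k + ω ^ α * l` for `k < d` and `1 ≤ l`.
If `α = 0` these are the isolated points, so that the point `0` belongs to them as well. -/
def N (α : Ordinal.{u}) (d : ℕ) : Set (X α d) :=
  {x | (∃ k l : ℕ, k < d ∧ 1 ≤ l ∧
      (x : Ordinal.{u}) = ω ^ (α + 1) * (k : Ordinal.{u}) + ω ^ α * (l : Ordinal.{u})) ∨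
    (α = 0 ∧ (x : Ordinal.{u}) = 0)}

/-- The pure homeomorphism group: the homeomorphisms fixing every point of maximal rank. -/
def PH (α : Ordinal.{u}) (d : ℕ) : Subgroup (H α d) where
  carrier := {h | ∀ x ∈ M α d, h x = x}
  one_mem' := fun _ _ => rfl
  mul_mem' := by
    intro f g hf hg x hx
    change f (g x) = x
    rw [hg x hx, hf x hx]
  inv_mem' := by
    intro f hf x hx
    change f.symm x = x
    rw [Homeomorph.symm_apply_eq, hf x hx]

/-- The homeomorphisms inducing a finite permutation of the points of next-to-maximal rank,
i.e. moving only finitely many of these points. -/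
def F (α : Ordinal.{u}) (d : ℕ) : Subgroup (H α d) where
  carrier := {h | {x ∈ N α d | h x ≠ x}.Finite}
  one_mem' := by
    have h : {x ∈ N α d | (1 : H α d) x ≠ x} = ∅ := by
      ext x
      simp
    change Set.Finite _
    rw [h]
    exact Set.finite_empty
  mul_mem' := by
    intro f g hf hg
    refine (Set.Finite.union hf hg).subset ?_
    rintro x ⟨hx, hfg⟩
    by_cases h : g x = x
    · left
      refine ⟨hx, fun hc => hfg ?_⟩
      change f (g x) = x
      rw [h, hc]
    · exact Or.inr ⟨hx, h⟩
  inv_mem' := by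
    intro f hf
    refine Set.Finite.subset hf ?_
    rintro x ⟨hx, h⟩
    refine ⟨hx, fun hc => h ?_⟩
    change f.symm x = x
    rw [Homeomorph.symm_apply_eq, hc]

/-- The closure of `F α d` in `H α d` for the compact-open topology. -/
noncomputable def Fbar (α : Ordinal.{u}) (d : ℕ) : Subgroup (H α d) :=
  (F α d).topologicalClosure

end OrdinalHomeo

/-! The space is `d` columns, each the one-point compactification of a sequence of compact blocks
(`model`). The points at infinity form `M`, and the tops of the blocks form `N`, indexed by `Fin d ×
ℕ`. Homeomorphisms preserve Cantor–Bendixson rank (`apply_mem_rankSet`), so they permute `M` and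
`N`.

If a homeomorphism fixes `M`, continuity at infinity lets only finitely many points of `N` change
column. The net gain of each column is then a homomorphism, `flux`, to the zero-sum vectors of `ℤ ^
d`, a copy of `ℤ ^ (d - 1)`.

Its kernel in `PH` is `Fbar` (`mem_Fbar_iff`). Columns are clopen, so flux is locally constant in
the compact-open topology, and it vanishes on finite permutations. Conversely, a homeomorphism
without flux can be composed with block permutations supported farther and farther out so as to land
in `F` (`exists_tail_perm`), and these composites converge to it.

Translating blocks along `d - 1` lines, all sharing column `0` as their negative ends, splits the
flux map (`flux_shift`). Permuting whole columns splits the action on `M`. -/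

namespace OrdinalHomeo

/-! ### Split extensions as semidirect products. -/

section Splitting

theorem exists_semidirectProduct_mulEquiv {K E Q : Type*} [Group K] [Group E] [Group Q]
    (i : K →* E) (p : E →* Q) (s : Q →* E) (hi : Function.Injective i)
    (hex : i.range = p.ker) (hs : ∀ q, p (s q) = q) :
    ∃ (φ : Q →* MulAut K) (e : K ⋊[φ] Q ≃* E), ∀ k, e (SemidirectProduct.inl k) = i k := by
  let S : GroupExtension K E Q :=
    { inl := i
      rightHom := p
      inl_injective := hi
      range_inl_eq_ker_rightHom := hex
      rightHom_surjective := fun q => ⟨s q, hs q⟩ }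
  let t : S.Splitting := { s with rightInverse_rightHom := hs }
  exact ⟨t.conjAct, t.semidirectProductMulEquiv, fun k =>
    t.semidirectProductToGroupExtensionEquiv.map_inl k⟩

end Splitting

/-! ### Flux of permutations that almost preserve a colouring. -/

section Flux

variable {I κ : Type*}

/-- The permutations of `I` that change the value of `c : I → κ` at finitely many points only. -/
def almostPreserving (c : I → κ) : Subgroup (Equiv.Perm I) where
  carrier := {σ | {i | c (σ i) ≠ c i}.Finite}
  one_mem' := by simp
  mul_mem' := by
    intro σ τ hσ hτ
    refine ((hσ.preimage τ.injective.injOn).union hτ).subset ?_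
    intro i hi
    by_cases h : c (τ i) = c i
    · left
      intro hc
      exact hi (hc.trans h)
    · exact Or.inr h
  inv_mem' := by
    intro σ hσ
    refine (hσ.preimage (σ⁻¹).injective.injOn).subset ?_
    intro i hi hc
    apply hi
    simpa using hc.symm

theorem mem_almostPreserving {c : I → κ} {σ : Equiv.Perm I} :
    σ ∈ almostPreserving c ↔ {i | c (σ i) ≠ c i}.Finite := Iff.rfl

variable [DecidableEq κ]

/-- The change of `c` at `i` under `σ`, as an integer combination of elements of `κ`. -/
def jump (c : I → κ) (σ : Equiv.Perm I) (i : I) : κ → ℤ :=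
  Pi.single (c (σ i)) 1 - Pi.single (c i) 1

theorem jump_eq_zero {c : I → κ} {σ : Equiv.Perm I} {i : I} (h : c (σ i) = c i) :
    jump c σ i = 0 := by
  simp [jump, h]

theorem support_jump_subset (c : I → κ) (σ : Equiv.Perm I) :
    (jump c σ).support ⊆ {i | c (σ i) ≠ c i} :=
  fun _ hi h => hi (jump_eq_zero h)

/-- The net number of points that a permutation almost preserving `c` moves into each fiber. -/
noncomputable def flux (c : I → κ) : almostPreserving c →* Multiplicative (κ → ℤ) where
  toFun σ := Multiplicative.ofAdd (∑ᶠ i, jump c σ i)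
  map_one' := by simp [jump]
  map_mul' := by
    intro σ τ
    have hσ := σ.2.subset (support_jump_subset c σ)
    have hτ := τ.2.subset (support_jump_subset c τ)
    -- After reindexing the sum for `σ` along `τ`, the two jumps at each point telescope to that of
    -- `σ * τ`.
    rw [← ofAdd_add, ← finsum_comp_equiv τ.1 (f := jump c σ.1), ← finsum_add_distrib _ hτ]
    · congr 1
      refine finsum_congr fun i => ?_
      simp [jump]
    · exact hσ.preimage τ.1.injective.injOn

theorem flux_apply (c : I → κ) (σ : almostPreserving c) :
    (flux c σ).toAdd = ∑ᶠ i, jump c σ i := rfl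

theorem flux_eq_sum (c : I → κ) (σ : almostPreserving c) (T : Finset I)
    (hT : ∀ i, i ∉ T → c (σ.1 i) = c i) : (flux c σ).toAdd = ∑ i ∈ T, jump c σ i := by
  rw [flux_apply]
  refine finsum_eq_sum_of_support_subset _ fun i hi => ?_
  by_contra h
  exact hi (jump_eq_zero (hT i h))

theorem flux_eq_one_of_finite (c : I → κ) (σ : almostPreserving c)
    (h : {i | σ.1 i ≠ i}.Finite) : flux c σ = 1 := by
  apply Multiplicative.toAdd.injective
  rw [flux_eq_sum c σ h.toFinset]
  · simp only [jump, Finset.sum_sub_distrib]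
    rw [Equiv.Perm.sum_comp σ.1 h.toFinset (fun i => (Pi.single (c i) 1 : κ → ℤ)) (by simp)]
    simp
  · intro i hi
    have : σ.1 i = i := by simpa using hi
    rw [this]

/-- Each jump adds one to a fiber and removes one from a fiber. -/
theorem sum_flux [Fintype κ] (c : I → κ) (σ : almostPreserving c) :
    ∑ k, (flux c σ).toAdd k = 0 := by
  rw [flux_eq_sum c σ σ.2.toFinset]
  · simp only [Finset.sum_apply]
    rw [Finset.sum_comm]
    simp [jump]
  · intro i hi
    by_contra hc
    exact hi (σ.2.mem_toFinset.2 hc)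

end Flux

/-! ### Correcting permutations without flux, and realizing fluxes by translations. -/

section Shift

/-- A bijection from `S` to `T` extends to a permutation of the finite set `S ∪ T`, then by the
identity. -/
theorem exists_perm_image_eq {J : Type*} (S T : Finset J) (h : S.card = T.card) :
    ∃ f : Equiv.Perm J, {j | f j ≠ j}.Finite ∧ ∀ j, f j ∈ T ↔ j ∈ S := by
  classical
  let U : Finset J := S ∪ T
  have hS : Fintype.card {x : U // x.1 ∈ S} = S.card := by
    rw [← Fintype.card_coe]
    exact Fintype.card_congr
      { toFun := fun x => ⟨x.1.1, x.2⟩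
        invFun := fun x => ⟨⟨x.1, Finset.mem_union_left _ x.2⟩, x.2⟩
        left_inv := fun _ => rfl
        right_inv := fun _ => rfl }
  have hT : Fintype.card {x : U // x.1 ∈ T} = T.card := by
    rw [← Fintype.card_coe]
    exact Fintype.card_congr
      { toFun := fun x => ⟨x.1.1, x.2⟩
        invFun := fun x => ⟨⟨x.1, Finset.mem_union_right _ x.2⟩, x.2⟩
        left_inv := fun _ => rfl
        right_inv := fun _ => rfl }
  let e : {x : U // x.1 ∈ S} ≃ {x : U // x.1 ∈ T} :=
    Fintype.equivOfCardEq (by rw [hS, hT, h])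
  let g : Equiv.Perm U := e.extendSubtype
  refine ⟨Equiv.Perm.ofSubtype g, ?_, fun j => ?_⟩
  · refine U.finite_toSet.subset fun j hj => ?_
    by_contra hc
    exact hj (Equiv.Perm.ofSubtype_apply_of_not_mem g hc)
  · by_cases hj : j ∈ U
    · rw [Equiv.Perm.ofSubtype_apply_of_mem g hj]
      constructor
      · intro hm
        by_contra hc
        exact e.extendSubtype_not_mem ⟨j, hj⟩ hc hm
      · intro hm
        exact e.extendSubtype_mem ⟨j, hj⟩ hm
    · rw [Equiv.Perm.ofSubtype_apply_of_not_mem g hj]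
      have h1 : j ∉ S := fun hc => hj (Finset.mem_union_left _ hc)
      have h2 : j ∉ T := fun hc => hj (Finset.mem_union_right _ hc)
      simp [h1, h2]

variable {κ : Type*} [Fintype κ] [DecidableEq κ]

/-- A permutation of `κ × ℕ` without flux agrees, up to finitely many points, with the inverse of a
permutation supported in a given tail and preserving the columns. -/
theorem exists_tail_perm (σ : almostPreserving (Prod.fst : κ × ℕ → κ)) (hσ : flux _ σ = 1)
    (n : ℕ) (hn : ∀ i : κ × ℕ, n ≤ i.2 → (σ.1 i).1 = i.1) :
    ∃ τ : Equiv.Perm (κ × ℕ), (∀ i, i.2 < n → τ i = i) ∧ (∀ i, (τ i).1 = i.1) ∧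
      (∀ i, n ≤ i.2 → n ≤ (τ i).2) ∧ {i | σ.1 (τ i) ≠ i}.Finite := by
  let C : Finset (κ × ℕ) := Finset.univ ×ˢ Finset.range n
  have hC : ∀ i, i ∈ C ↔ i.2 < n := by simp [C]
  -- Vanishing flux enters here: all column changes start in `C`, which has `n` points in each
  -- column, so `σ` sends exactly `n` points of `C` into each column.
  have hcard : ∀ k, (C.filter fun i => (σ.1 i).1 = k).card = n := by
    intro k
    have h0 : (flux _ σ).toAdd k = 0 := by rw [hσ]; rfl
    rw [flux_eq_sum _ σ C (fun i hi => hn i (by simpa [hC] using hi)), Finset.sum_apply] at h0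
    simp only [jump, Pi.sub_apply, Finset.sum_sub_distrib, Pi.single_apply, sub_eq_zero] at h0
    have h1 : (∑ i ∈ C, if k = i.1 then (1 : ℤ) else 0) = n := by
      rw [Finset.sum_product, Finset.sum_eq_single k] <;> simp +contextual [eq_comm]
    rw [h1] at h0
    apply Nat.cast_injective (R := ℤ)
    rw [Finset.card_filter]
    push_cast
    rw [← h0]
    exact Finset.sum_congr rfl fun i _ => by simp [eq_comm]
  -- In column `k`, `f` carries the first `n` positions onto those occupied by the image of `C`.
  -- Hence `σ⁻¹ ∘ f` preserves the tail, and composing it with `σ` leaves only the finitary `f`.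
  have hf : ∀ k, ∃ f : Equiv.Perm ℕ, {j | f j ≠ j}.Finite ∧
      ∀ j, σ.1.symm (k, f j) ∈ C ↔ j < n := by
    intro k
    obtain ⟨f, hf1, hf2⟩ := exists_perm_image_eq (Finset.range n)
      ((C.filter fun i => (σ.1 i).1 = k).image fun i => (σ.1 i).2) (by
        rw [Finset.card_range, Finset.card_image_of_injOn, hcard]
        intro a ha b hb hab
        simp only [Finset.coe_filter, Set.mem_ofPred_eq] at ha hb
        exact σ.1.injective (Prod.ext (ha.2.trans hb.2.symm) hab))
    refine ⟨f, hf1, fun j => ?_⟩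
    rw [← Finset.mem_range, ← hf2]
    simp only [Finset.mem_image, Finset.mem_filter]
    constructor
    · intro h
      exact ⟨_, ⟨h, by simp⟩, by simp⟩
    · rintro ⟨a, ⟨ha, h1⟩, h2⟩
      have : σ.1 a = (k, f j) := Prod.ext h1 h2
      rwa [← this, Equiv.symm_apply_apply]
  choose f hf1 hf2 using hf
  let g : Equiv.Perm (κ × ℕ) := Equiv.prodCongrRight f
  have hg : ∀ i, g i = (i.1, f i.1 i.2) := fun _ => rfl
  let ρ : Equiv.Perm (κ × ℕ) := g.trans σ.1.symm
  have hρ : ∀ i, n ≤ (ρ i).2 ↔ n ≤ i.2 := by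
    intro i
    have := hf2 i.1 i.2
    rw [hC] at this
    exact not_lt.symm.trans (this.not.trans not_lt)
  have hρ1 : ∀ i, n ≤ i.2 → (ρ i).1 = i.1 := by
    intro i hi
    have h := hn (ρ i) ((hρ i).2 hi)
    rw [← h]
    simp [ρ, hg]
  let τ : Equiv.Perm (κ × ℕ) := Equiv.Perm.ofSubtype
    (ρ.subtypePerm (p := fun i => n ≤ i.2) (fun i => hρ i))
  have hτ1 : ∀ i, i.2 < n → τ i = i := fun i hi =>
    Equiv.Perm.ofSubtype_apply_of_not_mem _ (not_le.2 hi)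
  have hτ2 : ∀ i, n ≤ i.2 → τ i = ρ i := fun i hi =>
    Equiv.Perm.ofSubtype_apply_of_mem (p := fun i : κ × ℕ => n ≤ i.2) _ hi
  refine ⟨τ, hτ1, fun i => ?_, fun i hi => ?_, ?_⟩
  · rcases lt_or_ge i.2 n with h | h
    · rw [hτ1 i h]
    · rw [hτ2 i h, hρ1 i h]
  · rw [hτ2 i hi]
    exact (hρ i).2 hi
  · have hfin : (⋃ k, (Prod.mk k) '' {j | f k j ≠ j}).Finite :=
      Set.finite_iUnion fun k => (hf1 k).image _
    refine (C.finite_toSet.union hfin).subset fun i hi => ?_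
    rcases lt_or_ge i.2 n with h | h
    · exact Or.inl ((hC i).2 h)
    · right
      rw [Set.mem_iUnion]
      refine ⟨i.1, i.2, fun hc => hi ?_, rfl⟩
      rw [hτ2 i h]
      simp [ρ, hg, hc]

/-- The bijection from `m + 1` copies of `ℕ` to `m` copies of `ℤ` that identifies all but the first
copy of `ℕ` with the nonnegative half-lines. -/
def halfLinesEquiv (m : ℕ) [NeZero m] : Fin (m + 1) × ℕ ≃ Fin m × ℤ where
  toFun i := Fin.cases (motive := fun _ => Fin m × ℤ)
    -- Column `0` is dealt out modulo `m` to the negative half-lines.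
    ((Nat.divModEquiv m i.2).2, Int.negSucc (Nat.divModEquiv m i.2).1)
    (fun j => (j, Int.ofNat i.2)) i.1
  invFun
    | (j, Int.ofNat n) => (j.succ, n)
    | (j, Int.negSucc q) => (0, (Nat.divModEquiv m).symm (q, j))
  left_inv := by
    rintro ⟨k, n⟩
    refine Fin.cases ?_ (fun j => ?_) k
    · exact Prod.ext rfl ((Nat.divModEquiv m).symm_apply_apply n)
    · rfl
  right_inv := by
    rintro ⟨j, n | q⟩
    · rfl
    · have h := (Nat.divModEquiv m).apply_symm_apply (q, j)
      exact Prod.ext (congrArg Prod.snd h) (congrArg (Int.negSucc ∘ Prod.fst) h)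

theorem halfLinesEquiv_symm_fst_of_nonneg {m : ℕ} [NeZero m] (j : Fin m) {z : ℤ} (hz : 0 ≤ z) :
    ((halfLinesEquiv m).symm (j, z)).1 = j.succ := by
  obtain ⟨n, rfl⟩ := Int.eq_ofNat_of_zero_le hz
  rfl

theorem halfLinesEquiv_symm_fst_of_neg {m : ℕ} [NeZero m] (j : Fin m) {z : ℤ} (hz : z < 0) :
    ((halfLinesEquiv m).symm (j, z)).1 = 0 := by
  obtain ⟨n, rfl⟩ := Int.eq_negSucc_of_lt_zero hz
  rfl

/-- The translation action of `ℤ ^ m` on `m` copies of `ℤ`. -/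
def translation (m : ℕ) : Multiplicative (Fin m → ℤ) →* Equiv.Perm (Fin m × ℤ) where
  toFun v := Equiv.prodCongrRight fun j => Equiv.addRight (v.toAdd j)
  map_one' := Equiv.ext fun x => Prod.ext rfl (add_zero x.2)
  map_mul' v w := Equiv.ext fun x => Prod.ext rfl <| by
    change x.2 + (v.toAdd x.1 + w.toAdd x.1) = x.2 + w.toAdd x.1 + v.toAdd x.1
    ring

/-- The translation action, on `m + 1` copies of `ℕ`. -/
def shiftPerm (m : ℕ) [NeZero m] :
    Multiplicative (Fin m → ℤ) →* Equiv.Perm (Fin (m + 1) × ℕ) :=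
  ((halfLinesEquiv m).symm.permCongrHom.toMonoidHom).comp (translation m)

theorem shiftPerm_symm_apply (m : ℕ) [NeZero m] (v : Multiplicative (Fin m → ℤ)) (j : Fin m)
    (z : ℤ) : shiftPerm m v ((halfLinesEquiv m).symm (j, z)) =
      (halfLinesEquiv m).symm (j, z + v.toAdd j) := by
  simp [shiftPerm, translation, Equiv.permCongrHom]

/-- On a given line, the column depends only on the sign of the integer coordinate. -/
theorem shiftPerm_fst_eq (m : ℕ) [NeZero m] (v : Multiplicative (Fin m → ℤ)) (j : Fin m) (z : ℤ)
    (h : 0 ≤ z ↔ 0 ≤ z + v.toAdd j) :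
    (shiftPerm m v ((halfLinesEquiv m).symm (j, z))).1 = ((halfLinesEquiv m).symm (j, z)).1 := by
  rw [shiftPerm_symm_apply]
  by_cases hz : 0 ≤ z
  · rw [halfLinesEquiv_symm_fst_of_nonneg j hz, halfLinesEquiv_symm_fst_of_nonneg j (h.1 hz)]
  · rw [halfLinesEquiv_symm_fst_of_neg j (not_le.1 hz),
      halfLinesEquiv_symm_fst_of_neg j (not_le.1 (h.not.1 hz))]

theorem shiftPerm_mem (m : ℕ) [NeZero m] (v : Multiplicative (Fin m → ℤ)) :
    shiftPerm m v ∈ almostPreserving (Prod.fst : Fin (m + 1) × ℕ → Fin (m + 1)) := by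
  rw [mem_almostPreserving]
  have hfin : (⋃ j, (fun z => (halfLinesEquiv m).symm (j, z)) ''
      Set.Icc (-|v.toAdd j|) |v.toAdd j|).Finite :=
    Set.finite_iUnion fun j => (Set.finite_Icc _ _).image _
  refine hfin.subset fun i hi => ?_
  obtain ⟨⟨j, z⟩, rfl⟩ := (halfLinesEquiv m).symm.surjective i
  rw [Set.mem_iUnion]
  refine ⟨j, z, ?_, rfl⟩
  by_contra hz
  apply hi
  apply shiftPerm_fst_eq
  rw [Set.mem_Icc, not_and_or, not_le, not_le] at hz
  have h1 := neg_abs_le (v.toAdd j)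
  have h2 := le_abs_self (v.toAdd j)
  omega

/-- The translation action, by permutations almost preserving the copies of `ℕ`. -/
def shift (m : ℕ) [NeZero m] : Multiplicative (Fin m → ℤ) →*
    almostPreserving (Prod.fst : Fin (m + 1) × ℕ → Fin (m + 1)) :=
  (shiftPerm m).codRestrict _ (shiftPerm_mem m)

theorem flux_shift (m : ℕ) [NeZero m] (v : Multiplicative (Fin m → ℤ)) (j : Fin m) :
    (flux _ (shift m v)).toAdd j.succ = v.toAdd j := by
  let F : (Fin m → ℤ) →+ ℤ := (Pi.evalAddMonoidHom (fun _ : Fin (m + 1) => ℤ) j.succ).comp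
    (MonoidHom.toAdditive ((flux _).comp (shift m)))
  -- Both sides are additive in `v`, so unit vectors suffice.
  suffices h : F = Pi.evalAddMonoidHom (fun _ : Fin m => ℤ) j from DFunLike.congr_fun h v.toAdd
  refine AddMonoidHom.functions_ext' _ _ _ fun l => ?_
  ext
  change (flux _ (shift m (Multiplicative.ofAdd (Pi.single l 1)))).toAdd j.succ =
    (Pi.single l 1 : Fin m → ℤ) j
  have hs : ∀ i, (shift m (Multiplicative.ofAdd (Pi.single l 1))).1 i =
    shiftPerm m (Multiplicative.ofAdd (Pi.single l 1)) i := fun _ => rfl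
  -- A unit translation of line `l` changes the column only at `-1`, which passes from column `0` to
  -- column `l + 1`.
  rw [flux_eq_sum _ _ {(halfLinesEquiv m).symm (l, -1)}]
  · rw [Finset.sum_singleton, jump, hs, shiftPerm_symm_apply,
      halfLinesEquiv_symm_fst_of_neg l (z := -1) (by norm_num),
      halfLinesEquiv_symm_fst_of_nonneg l (by simp)]
    simp [Pi.single_apply]
  · intro i hi
    obtain ⟨⟨p, z⟩, rfl⟩ := (halfLinesEquiv m).symm.surjective i
    rw [Finset.mem_singleton, (halfLinesEquiv m).symm.injective.eq_iff, Prod.mk.injEq] at hi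
    rw [hs]
    apply shiftPerm_fst_eq
    rw [toAdd_ofAdd, Pi.single_apply]
    split_ifs with hp
    · have : z ≠ -1 := fun h => hi ⟨hp, h⟩
      omega
    · simp

end Shift

open Filter Topology OnePoint

set_option linter.unusedSectionVars false

/-! ### Homeomorphisms that permute blocks or columns. -/

section Blocks

variable {κ B : Type*} [TopologicalSpace B] [CompactSpace B]

/-- Since `B` is compact, a compact set meets finitely many blocks, so neighbourhoods of infinity
are tails. -/
theorem coclosedCompact_nat_prod : coclosedCompact (ℕ × B) = comap Prod.fst atTop := by
  apply le_antisymm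
  · rw [← tendsto_iff_comap, tendsto_atTop]
    intro n
    refine hasBasis_coclosedCompact.mem_iff.2 ⟨Set.Iio n ×ˢ Set.univ, ⟨?_, ?_⟩, ?_⟩
    · exact (isClosed_discrete _).prod isClosed_univ
    · exact (Set.finite_Iio n).isCompact.prod isCompact_univ
    · intro x hx
      simpa using hx
  · intro s hs
    obtain ⟨t, ⟨-, ht⟩, hts⟩ := hasBasis_coclosedCompact.mem_iff.1 hs
    have hfin : (Prod.fst '' t).Finite := (ht.image continuous_fst).finite_of_discrete
    obtain ⟨n, hn⟩ := hfin.bddAbove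
    refine mem_comap.2 ⟨Set.Ioi n, Ioi_mem_atTop n, fun x hx => hts fun hxt => ?_⟩
    exact absurd (hn ⟨x, hxt, rfl⟩) (not_le.2 hx)

/-- The permutation `σ` of `κ × ℕ` acting on the blocks of `κ × OnePoint (ℕ × B)`. -/
def blockMap (B : Type*) (σ : Equiv.Perm (κ × ℕ)) (w : κ × OnePoint (ℕ × B)) :
    κ × OnePoint (ℕ × B) :=
  w.2.elim (w.1, ∞) fun x => ((σ (w.1, x.1)).1, OnePoint.some ((σ (w.1, x.1)).2, x.2))

@[simp]
theorem blockMap_infty (σ : Equiv.Perm (κ × ℕ)) (k : κ) : blockMap B σ (k, ∞) = (k, ∞) := rfl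

@[simp]
theorem blockMap_coe (σ : Equiv.Perm (κ × ℕ)) (k : κ) (x : ℕ × B) :
    blockMap B σ (k, x) = ((σ (k, x.1)).1, OnePoint.some ((σ (k, x.1)).2, x.2)) := rfl

theorem blockMap_mul (σ τ : Equiv.Perm (κ × ℕ)) (w : κ × OnePoint (ℕ × B)) :
    blockMap B (σ * τ) w = blockMap B σ (blockMap B τ w) := by
  obtain ⟨k, y⟩ := w
  induction y using OnePoint.rec <;> simp

theorem blockMap_one (w : κ × OnePoint (ℕ × B)) : blockMap B 1 w = w := by
  obtain ⟨k, y⟩ := w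
  induction y using OnePoint.rec <;> simp

variable [TopologicalSpace κ] [DiscreteTopology κ]

/-- Only infinity needs care: far out the column is unchanged, and the block index tends to infinity
because an injection hits each of the finitely many initial positions at most once. -/
theorem continuous_blockMap [Finite κ] {σ : Equiv.Perm (κ × ℕ)}
    (hσ : σ ∈ almostPreserving (Prod.fst : κ × ℕ → κ)) : Continuous (blockMap B σ) := by
  rw [continuous_prod_of_discrete_left]
  intro k
  rw [OnePoint.continuous_iff]
  constructor
  · have h1 : ∀ᶠ n in atTop, (σ (k, n)).1 = k := by
      rw [← Nat.cofinite_eq_atTop]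
      exact (hσ.preimage (Prod.mk_right_injective k).injOn)
    have h2 : Tendsto (fun n => (σ (k, n)).2) atTop atTop := by
      rw [tendsto_atTop]
      intro N
      rw [← Nat.cofinite_eq_atTop]
      have hfin : ((Set.univ : Set κ) ×ˢ Set.Iio N).Finite :=
        Set.finite_univ.prod (Set.finite_Iio N)
      refine (hfin.preimage (f := fun n => σ (k, n))
        (σ.injective.comp (Prod.mk_right_injective k)).injOn).subset fun n hn => ?_
      simpa using hn
    rw [coclosedCompact_nat_prod, blockMap_infty, nhds_prod_eq]
    refine Tendsto.prodMk ?_ ?_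
    · rw [nhds_discrete, tendsto_pure]
      exact tendsto_comap.eventually h1
    · refine OnePoint.tendsto_coe_infty.comp ?_
      rw [coclosedCompact_nat_prod, tendsto_comap_iff]
      exact h2.comp tendsto_comap
  · rw [continuous_prod_of_discrete_left]
    intro n
    have h : Continuous fun b : B => ((σ (k, n)).2, b) := Continuous.prodMk_right _
    exact Continuous.prodMk (f := fun _ => (σ (k, n)).1)
      (g := fun b => OnePoint.some ((σ (k, n)).2, b)) continuous_const
      (OnePoint.continuous_coe.comp h)

variable {X : Type*} [TopologicalSpace X] (Φ : κ × OnePoint (ℕ × B) ≃ₜ X)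

/-- The action on `X` of permutations of the blocks. -/
def blockHomeo [Finite κ] : almostPreserving (Prod.fst : κ × ℕ → κ) →* (X ≃ₜ X) where
  toFun σ :=
    { toFun := fun x => Φ (blockMap B σ.1 (Φ.symm x))
      invFun := fun x => Φ (blockMap B (σ⁻¹).1 (Φ.symm x))
      left_inv := fun x => by
        dsimp only
        rw [Φ.symm_apply_apply, ← blockMap_mul, ← Subgroup.coe_mul, inv_mul_cancel,
          Subgroup.coe_one, blockMap_one, Φ.apply_symm_apply]
      right_inv := fun x => by
        dsimp only
        rw [Φ.symm_apply_apply, ← blockMap_mul, ← Subgroup.coe_mul, mul_inv_cancel,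
          Subgroup.coe_one, blockMap_one, Φ.apply_symm_apply]
      continuous_toFun := Φ.continuous.comp
        ((continuous_blockMap σ.2).comp Φ.symm.continuous)
      continuous_invFun := Φ.continuous.comp
        ((continuous_blockMap (σ⁻¹).2).comp Φ.symm.continuous) }
  map_one' := Homeomorph.ext fun x => by
    change Φ (blockMap B 1 (Φ.symm x)) = x
    rw [blockMap_one, Φ.apply_symm_apply]
  map_mul' σ τ := Homeomorph.ext fun x => by
    change Φ (blockMap B (σ.1 * τ.1) (Φ.symm x)) =
      Φ (blockMap B σ.1 (Φ.symm (Φ (blockMap B τ.1 (Φ.symm x)))))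
    rw [blockMap_mul, Φ.symm_apply_apply]

theorem blockHomeo_apply [Finite κ] (σ : almostPreserving (Prod.fst : κ × ℕ → κ))
    (w : κ × OnePoint (ℕ × B)) : blockHomeo Φ σ (Φ w) = Φ (blockMap B σ.1 w) := by
  change Φ (blockMap B σ.1 (Φ.symm (Φ w))) = _
  rw [Φ.symm_apply_apply]

/-- The action on `X` of permutations of the columns. -/
def columnHomeo : Equiv.Perm κ →* (X ≃ₜ X) where
  toFun π := (Φ.symm.trans
    (π.toHomeomorphOfDiscrete.prodCongr (Homeomorph.refl _))).trans Φ
  map_one' := Homeomorph.ext fun x => Φ.apply_symm_apply x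
  map_mul' π ρ := Homeomorph.ext fun x => by
    change Φ (π (ρ (Φ.symm x).1), (Φ.symm x).2) =
      Φ (π (Φ.symm (Φ (ρ (Φ.symm x).1, (Φ.symm x).2))).1,
        (Φ.symm (Φ (ρ (Φ.symm x).1, (Φ.symm x).2))).2)
    rw [Φ.symm_apply_apply]

theorem columnHomeo_apply (π : Equiv.Perm κ) (k : κ) (y : OnePoint (ℕ × B)) :
    columnHomeo Φ π (Φ (k, y)) = Φ (π k, y) := by
  change Φ (π (Φ.symm (Φ (k, y))).1, (Φ.symm (Φ (k, y))).2) = _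
  rw [Φ.symm_apply_apply]

theorem tendsto_block (k : κ) (b : B) :
    Tendsto (fun n : ℕ => Φ (k, OnePoint.some (n, b))) atTop (𝓝 (Φ (k, ∞))) := by
  refine (Φ.continuous.tendsto _).comp ?_
  rw [nhds_prod_eq]
  refine tendsto_const_nhds.prodMk (OnePoint.tendsto_coe_infty.comp ?_)
  rw [coclosedCompact_nat_prod, tendsto_comap_iff]
  exact tendsto_id

/-- Whole blocks converge, uniformly in `b`; this makes block permutations far out negligible in the
compact-open topology. -/
theorem eventually_block_mem {U : Set X} {k : κ} (hU : U ∈ 𝓝 (Φ (k, ∞))) :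
    ∀ᶠ n in atTop, ∀ b : B, Φ (k, OnePoint.some (n, b)) ∈ U := by
  have h1 : Tendsto (fun x : ℕ × B => Φ (k, x)) (coclosedCompact _) (𝓝 (Φ (k, ∞))) := by
    refine (Φ.continuous.tendsto _).comp ?_
    rw [nhds_prod_eq]
    exact tendsto_const_nhds.prodMk OnePoint.tendsto_coe_infty
  have h2 := h1 hU
  rw [coclosedCompact_nat_prod, mem_map, mem_comap] at h2
  obtain ⟨t, ht, htU⟩ := h2
  filter_upwards [ht] with n hn b
  exact htU (a := (n, b)) hn

end Blocks

/-! ### Induced permutations and the compact-open topology. -/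

section Homeo

variable {X : Type*} [TopologicalSpace X]

theorem exists_induced_perm {I : Type*} (p : I → X) (hp : Function.Injective p)
    (hinv : ∀ (h : X ≃ₜ X) i, ∃ j, h (p i) = p j) :
    ∃ ρ : (X ≃ₜ X) →* Equiv.Perm I, ∀ h i, h (p i) = p (ρ h i) := by
  choose a ha using hinv
  let A : (X ≃ₜ X) →* Function.End I :=
    { toFun := a
      map_one' := funext fun i => hp (ha 1 i).symm
      map_mul' := fun g h => funext fun i => hp <| by
        rw [← ha]
        change g (h (p i)) = p (a g (a h i))
        rw [ha, ha] }
  exact ⟨A.toHomPerm, ha⟩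

/-- The fibers of `c ∘ h` are compact and those of `c` are open, so finitely many subbasic
conditions suffice. -/
theorem eventually_forall_apply_eq [CompactSpace X] {κ : Type*} [Finite κ] [TopologicalSpace κ]
    [DiscreteTopology κ] {c : X → κ} (hc : Continuous c) (h : X ≃ₜ X) :
    ∀ᶠ g : X ≃ₜ X in 𝓝 h, ∀ x, c (g x) = c (h x) := by
  have key : ∀ k, ∀ᶠ g : X ≃ₜ X in 𝓝 h, ∀ x, c (h x) = k → c (g x) = k := by
    intro k
    have hi : Continuous fun h : X ≃ₜ X => (⟨h, h.continuous⟩ : C(X, X)) :=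
      continuous_induced_dom
    have hK : IsCompact {x | c (h x) = k} :=
      ((isClosed_discrete {k}).preimage (hc.comp h.continuous)).isCompact
    have hU : IsOpen {x | c x = k} := (isOpen_discrete {k}).preimage hc
    exact ((ContinuousMap.isOpen_setOfPred_mapsTo hK hU).preimage hi).mem_nhds fun x hx => hx
  filter_upwards [eventually_all.2 key] with g hg x
  exact hg _ x rfl

theorem tendsto_homeo_iff {ι : Type*} {l : Filter ι} {f : ι → (X ≃ₜ X)} {h : X ≃ₜ X} :
    Tendsto f l (𝓝 h) ↔ ∀ K, IsCompact K → ∀ U, IsOpen U → Set.MapsTo h K U →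
      ∀ᶠ a in l, Set.MapsTo (f a) K U := by
  rw [nhds_induced, tendsto_comap_iff, ContinuousMap.tendsto_nhds_compactOpen]
  rfl

end Homeo

/-! ### Flux of homeomorphisms and its kernel. -/

section PureHomeo

variable {κ B X : Type*} [TopologicalSpace B] [CompactSpace B] [TopologicalSpace κ]
  [DiscreteTopology κ] [Fintype κ] [TopologicalSpace X] [T2Space X]
  (Φ : κ × OnePoint (ℕ × B) ≃ₜ X) (b : B)

/-- The point of the block `i` corresponding to `b`. -/
def blockPoint (i : κ × ℕ) : X := Φ (i.1, OnePoint.some (i.2, b))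

theorem blockPoint_injective : Function.Injective (blockPoint Φ b) := by
  rintro ⟨k, n⟩ ⟨l, m⟩ h
  have := Φ.injective h
  simp only [Prod.mk.injEq, OnePoint.coe_eq_coe] at this
  exact Prod.ext this.1 this.2.1

variable {ρ : (X ≃ₜ X) →* Equiv.Perm (κ × ℕ)}

/-- The images of the block points of column `k` converge to its fixed end, so they eventually enter
this clopen column. -/
theorem perm_mem_almostPreserving
    (hρ : ∀ h i, h (blockPoint Φ b i) = blockPoint Φ b (ρ h i))
    {h : X ≃ₜ X} (hh : ∀ k, h (Φ (k, ∞)) = Φ (k, ∞)) :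
    ρ h ∈ almostPreserving (Prod.fst : κ × ℕ → κ) := by
  have key : ∀ k, {n : ℕ | (ρ h (k, n)).1 ≠ k}.Finite := by
    intro k
    have h1 : Tendsto (fun n : ℕ => h (blockPoint Φ b (k, n))) atTop (𝓝 (Φ (k, ∞))) := by
      have := (h.continuous.tendsto _).comp (tendsto_block Φ k b)
      rwa [hh] at this
    have h2 : {x | (Φ.symm x).1 = k} ∈ 𝓝 (Φ (k, ∞)) := by
      refine IsOpen.mem_nhds ?_ ?_
      · exact (isOpen_discrete {k}).preimage (continuous_fst.comp Φ.symm.continuous)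
      · simp
    have h3 := h1 h2
    rw [← Nat.cofinite_eq_atTop] at h3
    refine Set.Finite.subset h3 fun n hn hc => hn ?_
    change (Φ.symm (h (blockPoint Φ b (k, n)))).1 = k at hc
    rw [hρ] at hc
    simpa [blockPoint] using hc
  refine (Set.finite_iUnion fun k => (key k).image (Prod.mk k)).subset fun i hi => ?_
  exact Set.mem_iUnion.2 ⟨i.1, i.2, hi, rfl⟩

theorem apply_infty_eq_of_finite
    (hρ : ∀ h i, h (blockPoint Φ b i) = blockPoint Φ b (ρ h i))
    {h : X ≃ₜ X} (hh : {i | ρ h i ≠ i}.Finite) (k : κ) :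
    h (Φ (k, ∞)) = Φ (k, ∞) := by
  have h1 := (h.continuous.tendsto _).comp (tendsto_block Φ k b)
  refine tendsto_nhds_unique h1 ((tendsto_block Φ k b).congr' ?_)
  rw [← Nat.cofinite_eq_atTop]
  refine (hh.preimage (Prod.mk_right_injective k).injOn).subset fun n hn hc => hn ?_
  have := hρ h (k, n)
  rw [hc] at this
  exact this.symm

variable [DecidableEq κ]

theorem flux_eq_of_forall
    (hρ : ∀ h i, h (blockPoint Φ b i) = blockPoint Φ b (ρ h i))
    {g h : X ≃ₜ X}
    (hg : ρ g ∈ almostPreserving (Prod.fst : κ × ℕ → κ))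
    (hh : ρ h ∈ almostPreserving (Prod.fst : κ × ℕ → κ))
    (hgh : ∀ x, (Φ.symm (g x)).1 = (Φ.symm (h x)).1) :
    flux _ ⟨ρ g, hg⟩ = flux _ ⟨ρ h, hh⟩ := by
  apply Multiplicative.toAdd.injective
  rw [flux_apply, flux_apply]
  refine finsum_congr fun i => ?_
  have := hgh (blockPoint Φ b i)
  rw [hρ, hρ] at this
  simp only [blockPoint, Homeomorph.symm_apply_apply] at this
  simp only [jump, this]

theorem perm_blockHomeo
    (hρ : ∀ h i, h (blockPoint Φ b i) = blockPoint Φ b (ρ h i))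
    (σ : almostPreserving (Prod.fst : κ × ℕ → κ)) :
    ρ (blockHomeo Φ σ) = σ.1 := by
  ext1 i
  apply blockPoint_injective Φ b
  rw [← hρ]
  exact blockHomeo_apply Φ σ _

/-- A homeomorphism without flux is a limit of homeomorphisms inducing finite permutations. -/
theorem mem_closure_of_flux_eq_one
    (hρ : ∀ h i, h (blockPoint Φ b i) = blockPoint Φ b (ρ h i))
    {h : X ≃ₜ X}
    (hm : ρ h ∈ almostPreserving (Prod.fst : κ × ℕ → κ)) (hf : flux _ ⟨ρ h, hm⟩ = 1) :
    h ∈ closure {g : X ≃ₜ X | {i | ρ g i ≠ i}.Finite} := by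
  obtain ⟨n₀, hn₀⟩ : ∃ n₀ : ℕ, ∀ i : κ × ℕ, n₀ ≤ i.2 → (ρ h i).1 = i.1 := by
    obtain ⟨N, hN⟩ := (Set.Finite.image Prod.snd hm).bddAbove
    refine ⟨N + 1, fun i hi => ?_⟩
    by_contra hc
    have := hN ⟨i, hc, rfl⟩
    omega
  have hτ := fun n => exists_tail_perm ⟨ρ h, hm⟩ hf (n₀ + n)
    fun i hi => hn₀ i (le_trans (Nat.le_add_right _ _) hi)
  choose τ hτ1 hτ2 hτ3 hτ4 using hτ
  let σ : ℕ → almostPreserving (Prod.fst : κ × ℕ → κ) := fun n => ⟨τ n, by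
    rw [mem_almostPreserving]
    simp [hτ2]⟩
  have hlim : Tendsto (fun n => h * blockHomeo Φ (σ n)) atTop (𝓝 h) := by
    rw [tendsto_homeo_iff]
    intro K hK U hU hKU
    -- Either `K` contains the end of the column, and `h` maps all far blocks into `U`, or `K`
    -- misses all far blocks.
    have key : ∀ k, ∀ᶠ n in atTop, ∀ l, n ≤ l → ∀ b, Φ (k, OnePoint.some (l, b)) ∈ K →
        ∀ l', n ≤ l' → ∀ b', h (Φ (k, OnePoint.some (l', b'))) ∈ U := by
      intro k
      by_cases hk : Φ (k, ∞) ∈ K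
      · have h1 : h ⁻¹' U ∈ 𝓝 (Φ (k, ∞)) :=
          (hU.preimage h.continuous).mem_nhds (hKU hk)
        filter_upwards [eventually_forall_ge_atTop.2 (eventually_block_mem Φ h1)] with n hn l _ _ _ l' hl' b'
        exact hn l' hl' b'
      · have h1 : Kᶜ ∈ 𝓝 (Φ (k, ∞)) := hK.isClosed.isOpen_compl.mem_nhds hk
        filter_upwards [eventually_forall_ge_atTop.2 (eventually_block_mem Φ h1)] with n hn l hl b hb
        exact absurd hb (hn l hl b)
    filter_upwards [eventually_all.2 key] with n hn x hx
    change h (blockHomeo Φ (σ n) x) ∈ U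
    obtain ⟨⟨k, y⟩, rfl⟩ := Φ.surjective x
    rw [blockHomeo_apply]
    induction y using OnePoint.rec with
    | infty => exact hKU hx
    | coe y =>
      obtain ⟨l, b'⟩ := y
      rw [blockMap_coe]
      change h (Φ ((τ n (k, l)).1, OnePoint.some ((τ n (k, l)).2, b'))) ∈ U
      rcases lt_or_ge l (n₀ + n) with hl | hl
      · rw [hτ1 n (k, l) hl]
        exact hKU hx
      · rw [hτ2]
        exact hn k l (le_trans (Nat.le_add_left _ _) hl) b' hx _
          (le_trans (Nat.le_add_left _ _) (hτ3 n (k, l) hl)) b'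
  refine mem_closure_of_tendsto hlim (Eventually.of_forall fun n => ?_)
  change {i | ρ (h * blockHomeo Φ (σ n)) i ≠ i}.Finite
  rw [map_mul, perm_blockHomeo Φ b hρ]
  exact hτ4 n

end PureHomeo

/-! ### Cantor–Bendixson rank of ordinals. -/

section Rank

theorem omega0_opow_pos (a : Ordinal.{u}) : 0 < ω ^ a := opow_pos a omega0_pos

theorem eq_and_eq_of_mul_add_eq {a q r q' r' : Ordinal.{u}} (hr : r < a) (hr' : r' < a)
    (h : a * q + r = a * q' + r') : q = q' ∧ r = r' := by
  have ha : a ≠ 0 := hr.ne_bot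
  have hq : q = q' := by
    have := congrArg (· / a) h
    simpa [mul_add_div _ ha, div_eq_zero_of_lt hr, div_eq_zero_of_lt hr'] using this
  subst hq
  exact ⟨rfl, add_left_cancel h⟩

/-- Here `c` is the last exponent of the Cantor normal form, reached by stripping leading terms; it
is the exact rank of `x`. -/
theorem exists_eq_omega0_opow_mul_add_one (x : Ordinal.{u}) (hx : x ≠ 0) :
    ∃ c s : Ordinal.{u}, x = ω ^ c * (s + 1) := by
  induction x using WellFoundedLT.induction with
  | ind x ih =>
    have hdiv := div_add_mod x (ω ^ log ω x)
    obtain ⟨q, hq⟩ := lt_omega0.1 (div_opow_log_lt x one_lt_omega0)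
    have hq0 := div_opow_log_pos ω hx
    rw [hq] at hdiv hq0
    by_cases hr : x % ω ^ log ω x = 0
    · rw [hr, add_zero] at hdiv
      obtain ⟨p, rfl⟩ := Nat.exists_eq_succ_of_ne_zero (by simpa using hq0.ne' : q ≠ 0)
      exact ⟨log ω x, p, by simpa using hdiv.symm⟩
    · obtain ⟨c, s, hcs⟩ := ih _ (mod_opow_log_lt_self ω hx) hr
      have hlt : ω ^ c < ω ^ log ω x := by
        refine lt_of_le_of_lt ?_ (mod_lt x (omega0_opow_pos _).ne')
        rw [hcs]
        exact le_mul_of_one_le_right' (by simp)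
      have hc : c ≤ log ω x := ((opow_lt_opow_iff_right one_lt_omega0).1 hlt).le
      obtain ⟨t, ht⟩ := opow_dvd_opow ω hc
      refine ⟨c, t * q + s, ?_⟩
      rw [add_assoc, mul_add, ← mul_assoc, ← ht, ← hcs, hdiv]

/-- The ordinals divisible by `ω ^ a`, without `0` unless `a = 0`. These are the ordinals of
Cantor–Bendixson rank at least `a`. -/
def rankSet (a : Ordinal.{u}) : Set Ordinal.{u} := {x | ω ^ a ∣ x ∧ (x = 0 → a = 0)}

/-- This recursion is purely topological, hence the invariance of rank. Below a nonzero multiple of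
`ω ^ (b + 1)` the multiples of `ω ^ b` are cofinal, whereas none lies strictly between `ω ^ c * s`
and `ω ^ c * (s + 1)` when `b = c`. -/
theorem mem_rankSet_iff (a x : Ordinal.{u}) :
    x ∈ rankSet a ↔ ∀ b < a, AccPt x (𝓟 (rankSet b)) := by
  simp only [SuccOrder.accPt_principal, isMin_iff_eq_bot, bot_eq_zero']
  constructor
  · rintro ⟨⟨y, rfl⟩, hx⟩ b hb
    have hx0 : ω ^ a * y ≠ 0 := fun h => (hb.trans_le (hx h).le).not_ge (by simp)
    refine ⟨hx0, fun p hp => ?_⟩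
    obtain ⟨z, hz⟩ := opow_dvd_opow ω (Order.add_one_le_of_lt hb)
    have he : ω ^ a * y = ω ^ b * (ω * (z * y)) := by
      rw [hz, opow_add_one]
      simp only [mul_assoc]
    rw [he] at hp hx0 ⊢
    have hl : Order.IsSuccLimit (ω * (z * y)) :=
      isSuccLimit_mul_left isSuccLimit_omega0
        (pos_iff_ne_zero.2 fun h => hx0 (by rw [h]; simp))
    obtain ⟨c, hc, hpc⟩ := (lt_mul_iff_of_isSuccLimit hl).1 hp
    refine ⟨ω ^ b * c, ⟨dvd_mul_right _ _, fun h => ?_⟩, hpc, ?_⟩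
    · rw [h] at hpc
      exact absurd hpc (by simp)
    · exact (mul_lt_mul_iff_of_pos_left (omega0_opow_pos b)).2 hc
  · intro h
    by_cases ha : a = 0
    · subst ha
      exact ⟨by simp, fun _ => rfl⟩
    have hx0 : x ≠ 0 := (h 0 (pos_iff_ne_zero.2 ha)).1
    refine ⟨?_, fun h => absurd h hx0⟩
    by_contra hdvd
    obtain ⟨c, s, rfl⟩ := exists_eq_omega0_opow_mul_add_one x hx0
    have hc : c < a := by
      by_contra hc
      exact hdvd (dvd_mul_of_dvd_left (opow_dvd_opow ω (not_lt.1 hc)) _)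
    obtain ⟨z, ⟨⟨y, rfl⟩, -⟩, h1, h2⟩ := (h c hc).2 (ω ^ c * s)
      ((mul_lt_mul_iff_of_pos_left (omega0_opow_pos c)).2 (by simp))
    have h1' : s < y := lt_of_mul_lt_mul_left' h1
    have h2' : y < s + 1 := lt_of_mul_lt_mul_left' h2
    exact absurd (Order.add_one_le_of_lt h1') (not_le.2 h2')

theorem accPt_coe_iff {t : Ordinal.{u}} (x : Set.Iio t) (S : Set Ordinal.{u}) :
    AccPt (x : Ordinal.{u}) (𝓟 S) ↔ AccPt x (𝓟 ((↑) ⁻¹' S : Set (Set.Iio t))) := by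
  rw [accPt_iff_frequently, accPt_iff_frequently,
    ← (isOpen_Iio (a := t)).isOpenEmbedding_subtypeVal.map_nhds_eq, frequently_map]
  simp [Subtype.ext_iff]

theorem apply_mem_rankSet {t : Ordinal.{u}} (h : Set.Iio t ≃ₜ Set.Iio t) (a : Ordinal.{u})
    (x : Set.Iio t) (hx : (x : Ordinal.{u}) ∈ rankSet a) : (h x : Ordinal.{u}) ∈ rankSet a := by
  induction a using WellFoundedLT.induction generalizing x with
  | ind a ih =>
    rw [mem_rankSet_iff] at hx ⊢
    intro b hb
    have hxb := hx b hb
    rw [accPt_coe_iff, accPt_iff_frequently] at hxb ⊢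
    rw [← h.map_nhds_eq, frequently_map]
    refine hxb.mono fun y hy => ⟨h.injective.ne hy.1, ih b hb y hy.2⟩

end Rank

/-! ### Homeomorphisms preserve `M` and `N`. -/

section Invariance

variable {α : Ordinal.{u}} {d : ℕ}

theorem mem_M_iff (x : X α d) : x ∈ M α d ↔ (x : Ordinal.{u}) ∈ rankSet (α + 1) := by
  constructor
  · rintro ⟨k, hk, -, hx⟩
    rw [hx]
    refine ⟨dvd_mul_right _ _, fun h => ?_⟩
    rcases mul_eq_zero.1 h with h | h
    · exact absurd h (omega0_opow_pos _).ne'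
    · have : k = 0 := by exact_mod_cast h
      omega
  · rintro ⟨⟨y, hy⟩, h0⟩
    have hxd : (x : Ordinal.{u}) ≤ ω ^ (α + 1) * d := Order.lt_add_one_iff.1 x.2
    rw [hy] at hxd
    have hyd : y ≤ d := le_of_mul_le_mul_left hxd (omega0_opow_pos _)
    obtain ⟨k, rfl⟩ := lt_omega0.1 (hyd.trans_lt (natCast_lt_omega0 d))
    refine ⟨k, ?_, by exact_mod_cast hyd, hy⟩
    by_contra hk
    have hk0 : k = 0 := by omega
    subst hk0
    exact absurd (h0 (by rw [hy]; simp)) (by simp)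

theorem mem_N_or_mem_M_iff (x : X α d) :
    x ∈ N α d ∨ x ∈ M α d ↔ (x : Ordinal.{u}) ∈ rankSet α := by
  constructor
  · rintro ((⟨k, l, -, hl, hx⟩ | ⟨rfl, hx⟩) | ⟨k, hk, -, hx⟩)
    · rw [hx, opow_add_one, mul_assoc, ← mul_add]
      refine ⟨dvd_mul_right _ _, fun h => ?_⟩
      have h1 := (mul_eq_zero.1 h).resolve_left (omega0_opow_pos _).ne'
      have h2 : (l : Ordinal.{u}) = 0 := by
        have : (l : Ordinal.{u}) ≤ 0 := h1 ▸ le_add_left le_rfl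
        simpa using this
      have : l = 0 := by exact_mod_cast h2
      omega
    · exact ⟨by simp, fun _ => rfl⟩
    · rw [hx]
      refine ⟨dvd_mul_of_dvd_left (opow_dvd_opow ω (by simp)) _, fun h => ?_⟩
      rcases mul_eq_zero.1 h with h | h
      · exact absurd h (omega0_opow_pos _).ne'
      · have : k = 0 := by exact_mod_cast h
        omega
  · rintro ⟨⟨y, hy⟩, h0⟩
    have hxd : (x : Ordinal.{u}) ≤ ω ^ (α + 1) * d := Order.lt_add_one_iff.1 x.2
    have hyd : y ≤ ω * d := by
      rw [hy, opow_add_one, mul_assoc] at hxd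
      exact le_of_mul_le_mul_left hxd (omega0_opow_pos _)
    have hdm := div_add_mod y ω
    obtain ⟨l, hl⟩ := lt_omega0.1 (mod_lt y omega0_ne_zero)
    have hk : y / ω ≤ d := by
      have := (mul_div_le y ω).trans hyd
      exact le_of_mul_le_mul_left this omega0_pos
    obtain ⟨k, hk'⟩ := lt_omega0.1 (hk.trans_lt (natCast_lt_omega0 d))
    rw [hk', hl] at hdm
    rw [hk'] at hk
    have hkd : k ≤ d := by exact_mod_cast hk
    have hx : (x : Ordinal.{u}) = ω ^ (α + 1) * k + ω ^ α * l := by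
      rw [hy, ← hdm, opow_add_one, mul_assoc, ← mul_add]
    rcases Nat.eq_zero_or_pos l with rfl | hl0
    · rcases Nat.eq_zero_or_pos k with rfl | hk0
      · have hx0 : (x : Ordinal.{u}) = 0 := by rw [hx]; simp
        exact Or.inl (Or.inr ⟨h0 hx0, hx0⟩)
      · exact Or.inr ⟨k, hk0, hkd, by rw [hx]; simp⟩
    · refine Or.inl (Or.inl ⟨k, l, lt_of_le_of_ne hkd ?_, hl0, hx⟩)
      rintro rfl
      rw [← hdm] at hyd
      have : (l : Ordinal.{u}) ≤ 0 := by simpa using hyd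
      have : l = 0 := by simpa using this
      omega

theorem disjoint_N_M : Disjoint (N α d) (M α d) := by
  rw [Set.disjoint_left]
  rintro x (⟨k, l, -, hl, hx⟩ | ⟨-, hx⟩) ⟨k', hk', -, hx'⟩
  · rw [hx, opow_add_one, mul_assoc, mul_assoc, ← mul_add] at hx'
    have h1 : ω * (k : Ordinal.{u}) + l = ω * k' + 0 := by
      rw [add_zero]
      exact (mul_right_inj' (omega0_opow_pos α).ne').1 hx'
    have h2 := (eq_and_eq_of_mul_add_eq (natCast_lt_omega0 l) omega0_pos h1).2
    have : l = 0 := by exact_mod_cast h2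
    omega
  · rw [hx] at hx'
    rcases mul_eq_zero.1 hx'.symm with h | h
    · exact absurd h (omega0_opow_pos _).ne'
    · have : k' = 0 := by exact_mod_cast h
      omega

theorem apply_mem_M (h : H α d) {x : X α d} (hx : x ∈ M α d) : h x ∈ M α d := by
  rw [mem_M_iff] at hx ⊢
  exact apply_mem_rankSet h _ x hx

theorem apply_mem_N (h : H α d) {x : X α d} (hx : x ∈ N α d) : h x ∈ N α d := by
  have h1 := apply_mem_rankSet h _ x ((mem_N_or_mem_M_iff x).1 (Or.inl hx))
  refine ((mem_N_or_mem_M_iff (h x)).2 h1).resolve_right fun hM => ?_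
  have h2 := apply_mem_M h.symm hM
  rw [h.symm_apply_apply] at h2
  exact Set.disjoint_left.1 disjoint_N_M hx h2

end Invariance

/-! ### The model by columns of blocks. -/

section Model

/-- The largest element of a block: `ω ^ α`, or `0` if `α = 0`. -/
noncomputable def blockTop (α : Ordinal.{u}) : Ordinal.{u} := open Classical in
  -- Each block must contain exactly one point of `N`; for `α = 0` the ordinal `ω ^ α + 1 = 2` would
  -- contain two.
  if α = 0 then 0 else ω ^ α

/-- The blocks: the successor ordinal `ω ^ α + 1`, or `1` if `α = 0`. -/
abbrev Block (α : Ordinal.{u}) : Type (u + 1) := Set.Iio (blockTop α + 1)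

instance (α : Ordinal.{u}) : OrderTopology (Block α) := orderTopology_of_ordConnected

instance (α : Ordinal.{u}) : CompactSpace (Block α) := by
  have h : Set.Iio (blockTop α + 1) = Set.Icc 0 (blockTop α) := by
    ext x
    simp [Order.lt_add_one_iff]
  exact isCompact_iff_compactSpace.1 (h ▸ isCompact_Icc)

theorem omega0_le_opow {α : Ordinal.{u}} (h : α ≠ 0) : ω ≤ ω ^ α :=
  left_le_opow ω (pos_iff_ne_zero.2 h)

theorem blockTop_add_one_mul_omega0 (α : Ordinal.{u}) : (blockTop α + 1) * ω = ω ^ (α + 1) := by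
  rw [opow_add_one, blockTop]
  split_ifs with h
  · simp [h]
  · exact add_mul_of_isSuccLimit (one_add_of_omega0_le (omega0_le_opow h)) isSuccLimit_omega0

theorem add_one_mul_natCast_add {a : Ordinal.{u}} (ha : ω ≤ a) (n : ℕ) :
    (a + 1) * (n : Ordinal.{u}) + a = a * ((n + 1 : ℕ) : Ordinal.{u}) := by
  have h := add_mul_add_one (n : Ordinal.{u}) (one_add_of_omega0_le ha)
  rw [mul_add_one, ← add_assoc] at h
  push_cast
  simpa using h

theorem add_one_mul_natCast {a : Ordinal.{u}} (ha : ω ≤ a) {n : ℕ} (hn : 0 < n) :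
    (a + 1) * (n : Ordinal.{u}) = a * (n : Ordinal.{u}) + 1 := by
  obtain ⟨m, rfl⟩ := Nat.exists_eq_succ_of_ne_zero hn.ne'
  have h := add_mul_add_one (m : Ordinal.{u}) (one_add_of_omega0_le ha)
  simpa using h

/-- The parametrization of `ω ^ (α + 1) + 1` by the one-point compactification of a sequence of
blocks. -/
noncomputable def columnMap (α : Ordinal.{u}) (y : OnePoint (ℕ × Block α)) : Ordinal.{u} :=
  y.elim (ω ^ (α + 1)) fun x => (blockTop α + 1) * (x.1 : Ordinal.{u}) + x.2

theorem columnMap_coe_lt (α : Ordinal.{u}) (x : ℕ × Block α) :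
    columnMap α (OnePoint.some x) < ω ^ (α + 1) := by
  rw [← blockTop_add_one_mul_omega0]
  exact lt_mul_iff.2 ⟨x.1, natCast_lt_omega0 _, x.2, x.2.2, rfl⟩

theorem columnMap_lt (α : Ordinal.{u}) (y : OnePoint (ℕ × Block α)) :
    columnMap α y < ω ^ (α + 1) + 1 := by
  rw [Order.lt_add_one_iff]
  induction y using OnePoint.rec with
  | infty => exact le_rfl
  | coe x => exact (columnMap_coe_lt α x).le

theorem columnMap_injective (α : Ordinal.{u}) : Function.Injective (columnMap α) := by
  intro y z h
  induction y using OnePoint.rec with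
  | infty =>
    induction z using OnePoint.rec with
    | infty => rfl
    | coe z => exact absurd h (columnMap_coe_lt α z).ne'
  | coe y =>
    induction z using OnePoint.rec with
    | infty => exact absurd h (columnMap_coe_lt α y).ne
    | coe z =>
      have := eq_and_eq_of_mul_add_eq y.2.2 z.2.2 h
      exact congrArg _ (Prod.ext (by exact_mod_cast this.1) (Subtype.ext this.2))

theorem exists_columnMap_eq {α x : Ordinal.{u}} (hx : x < ω ^ (α + 1) + 1) :
    ∃ y, columnMap α y = x := by
  rcases (Order.lt_add_one_iff.1 hx).eq_or_lt with rfl | h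
  · exact ⟨OnePoint.infty, rfl⟩
  · rw [← blockTop_add_one_mul_omega0] at h
    obtain ⟨q, hq, r, hr, rfl⟩ := lt_mul_iff.1 h
    obtain ⟨n, rfl⟩ := lt_omega0.1 hq
    exact ⟨OnePoint.some (n, ⟨r, hr⟩), rfl⟩

theorem continuous_columnMap (α : Ordinal.{u}) : Continuous (columnMap α) := by
  rw [OnePoint.continuous_iff]
  constructor
  · rw [coclosedCompact_nat_prod, tendsto_order]
    constructor
    · intro a (ha : a < ω ^ (α + 1))
      rw [← blockTop_add_one_mul_omega0, lt_mul_iff_of_isSuccLimit isSuccLimit_omega0] at ha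
      obtain ⟨c, hc, hac⟩ := ha
      obtain ⟨m, rfl⟩ := lt_omega0.1 hc
      filter_upwards [tendsto_comap.eventually (eventually_ge_atTop m)] with x hx
      refine hac.trans_le (le_trans ?_ (le_add_right le_rfl))
      gcongr
    · intro a ha
      exact Eventually.of_forall fun x => (columnMap_coe_lt α x).trans ha
  · rw [continuous_prod_of_discrete_left]
    intro n
    exact (isNormal_add_right ((blockTop α + 1) * (n : Ordinal.{u}))).continuous.comp
      continuous_subtype_val

variable (α : Ordinal.{u}) (d : ℕ)

theorem mul_add_columnMap_lt (w : Fin d × OnePoint (ℕ × Block α)) :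
    (ω ^ (α + 1) + 1) * ((w.1 : ℕ) : Ordinal.{u}) + columnMap α w.2 <
      ω ^ (α + 1) * (d : Ordinal.{u}) + 1 := by
  -- Concatenating `d > 0` columns of length `ω ^ (α + 1) + 1` absorbs every extra point except the
  -- last.
  rw [← add_one_mul_natCast (omega0_le_opow (by simp)) (Fin.pos w.1)]
  exact lt_mul_iff.2 ⟨_, by exact_mod_cast w.1.2, _, columnMap_lt α w.2, rfl⟩

/-- The parametrization of `ω ^ (α + 1) * d + 1` by `d` columns of blocks. -/
noncomputable def modelMap (w : Fin d × OnePoint (ℕ × Block α)) : X α d :=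
  ⟨_, mul_add_columnMap_lt α d w⟩

theorem modelMap_bijective (hd : 0 < d) : Function.Bijective (modelMap α d) := by
  constructor
  · rintro ⟨k, y⟩ ⟨l, z⟩ h
    have := eq_and_eq_of_mul_add_eq (columnMap_lt α y) (columnMap_lt α z) (Subtype.ext_iff.1 h)
    exact Prod.ext (Fin.ext (by exact_mod_cast this.1)) (columnMap_injective α this.2)
  · rintro ⟨x, hx⟩
    have hx' := hx
    rw [Set.mem_Iio, ← add_one_mul_natCast (omega0_le_opow (by simp)) hd] at hx'
    obtain ⟨q, hq, r, hr, rfl⟩ := lt_mul_iff.1 hx'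
    obtain ⟨k, rfl⟩ := lt_omega0.1 (hq.trans (natCast_lt_omega0 d))
    obtain ⟨y, rfl⟩ := exists_columnMap_eq hr
    exact ⟨(⟨k, by exact_mod_cast hq⟩, y), rfl⟩

theorem continuous_modelMap : Continuous (modelMap α d) := by
  refine Continuous.subtype_mk ?_ _
  rw [continuous_prod_of_discrete_left]
  intro k
  exact (isNormal_add_right ((ω ^ (α + 1) + 1) * ((k : ℕ) : Ordinal.{u}))).continuous.comp
    (continuous_columnMap α)

/-- The homeomorphism of `ω ^ (α + 1) * d + 1` with `d` columns of blocks. -/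
noncomputable def model (hd : 0 < d) : Fin d × OnePoint (ℕ × Block α) ≃ₜ X α d :=
  Continuous.homeoOfEquivCompactToT2 (f := Equiv.ofBijective _ (modelMap_bijective α d hd))
    (continuous_modelMap α d)

theorem mem_M_iff_exists (hd : 0 < d) (x : X α d) :
    x ∈ M α d ↔ ∃ k, model α d hd (k, OnePoint.infty) = x := by
  have key : ∀ k : Fin d, (model α d hd (k, OnePoint.infty) : Ordinal.{u}) =
      ω ^ (α + 1) * ((k + 1 : ℕ) : Ordinal.{u}) := fun k =>
    add_one_mul_natCast_add (omega0_le_opow (by simp)) k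
  constructor
  · rintro ⟨k, hk, hkd, hx⟩
    refine ⟨⟨k - 1, by omega⟩, Subtype.ext ?_⟩
    rw [key, hx]
    simp only
    rw [Nat.sub_add_cancel hk]
  · rintro ⟨k, rfl⟩
    exact ⟨k + 1, by omega, k.2, key k⟩

/-- The largest element of a block. -/
noncomputable def blockTopPoint : Block α := ⟨blockTop α, by simp⟩

theorem coe_blockPoint (hd : 0 < d) (k : Fin d) (n : ℕ) :
    (blockPoint (model α d hd) (blockTopPoint α) (k, n)).1 =
      (ω ^ (α + 1) + 1) * ((k : ℕ) : Ordinal.{u}) + ((blockTop α + 1) * n + blockTop α) := rfl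

theorem mem_N_iff_exists (hd : 0 < d) (x : X α d) :
    x ∈ N α d ↔ ∃ i, blockPoint (model α d hd) (blockTopPoint α) i = x := by
  have hγ : ω ≤ ω ^ (α + 1) := omega0_le_opow (by simp)
  by_cases hα : α = 0
  · have hB : blockTop α = 0 := by simp [blockTop, hα]
    -- For `α = 0` the first column starts at `0`, while column `k > 0` starts just after a limit
    -- point; only the latter shifts the index by one.
    have hz : ∀ n : ℕ, (blockPoint (model α d hd) (blockTopPoint α) (⟨0, hd⟩, n)).1
        = n := by
      intro n
      rw [coe_blockPoint, hB]
      simp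
    have hs : ∀ (k : Fin d) (n : ℕ), 0 < (k : ℕ) →
        (blockPoint (model α d hd) (blockTopPoint α) (k, n)).1 =
          ω ^ (α + 1) * ((k : ℕ) : Ordinal.{u}) + ω ^ α * ((n + 1 : ℕ) : Ordinal.{u}) := by
      intro k n hk
      rw [coe_blockPoint, hB, add_one_mul_natCast hγ hk, add_assoc]
      congr 1
      rw [hα, Nat.add_comm n 1]
      simp
    constructor
    · rintro (⟨k, l, hk, hl, hx⟩ | ⟨-, hx⟩)
      · rcases Nat.eq_zero_or_pos k with rfl | hk0
        · refine ⟨(⟨0, hd⟩, l), Subtype.ext ?_⟩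
          rw [hz, hx, hα]
          simp
        · refine ⟨(⟨k, hk⟩, l - 1), Subtype.ext ?_⟩
          rw [hs ⟨k, hk⟩ _ hk0, hx, Nat.sub_add_cancel hl]
      · refine ⟨(⟨0, hd⟩, 0), Subtype.ext ?_⟩
        rw [hz, hx]
        simp
    · rintro ⟨⟨k, n⟩, rfl⟩
      rcases Nat.eq_zero_or_pos (k : ℕ) with hk | hk
      · obtain rfl : k = ⟨0, hd⟩ := Fin.ext hk
        rcases Nat.eq_zero_or_pos n with rfl | hn
        · exact Or.inr ⟨hα, by rw [hz]; simp⟩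
        · exact Or.inl ⟨0, n, hd, hn, by rw [hz, hα]; simp⟩
      · exact Or.inl ⟨k, n + 1, k.2, by omega, hs k n hk⟩
  · have hB : blockTop α = ω ^ α := by simp [blockTop, hα]
    have hs : ∀ (k : Fin d) (n : ℕ),
        (blockPoint (model α d hd) (blockTopPoint α) (k, n)).1 =
          ω ^ (α + 1) * ((k : ℕ) : Ordinal.{u}) + ω ^ α * ((n + 1 : ℕ) : Ordinal.{u}) := by
      intro k n
      rw [coe_blockPoint, hB, add_one_mul_natCast_add (omega0_le_opow hα)]
      rcases Nat.eq_zero_or_pos (k : ℕ) with hk | hk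
      · rw [hk]
        simp
      -- The initial `1` of a later column is absorbed by the infinite term `ω ^ α * (n + 1)`.
      · rw [add_one_mul_natCast hγ hk, add_assoc, one_add_of_omega0_le]
        refine (omega0_le_opow hα).trans (le_mul_of_one_le_right' ?_)
        exact_mod_cast Nat.succ_le_succ (Nat.zero_le n)
    constructor
    · rintro (⟨k, l, hk, hl, hx⟩ | ⟨h, -⟩)
      · refine ⟨(⟨k, hk⟩, l - 1), Subtype.ext ?_⟩
        rw [hs, hx, Nat.sub_add_cancel hl]
      · exact absurd h hα
    · rintro ⟨⟨k, n⟩, rfl⟩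
      exact Or.inl ⟨k, n + 1, k.2, by omega, hs k n⟩

end Model

/-! ### The two split extensions. -/

section Main

variable {α : Ordinal.{u}} {d : ℕ}

theorem mem_PH_iff (hd : 0 < d) (h : H α d) :
    h ∈ PH α d ↔ ∀ k, h (model α d hd (k, OnePoint.infty)) = model α d hd (k, OnePoint.infty) := by
  constructor
  · intro hh k
    exact hh _ ((mem_M_iff_exists α d hd _).2 ⟨k, rfl⟩)
  · intro hh x hx
    obtain ⟨k, rfl⟩ := (mem_M_iff_exists α d hd x).1 hx
    exact hh k

theorem isClosed_PH : IsClosed (PH α d : Set (H α d)) := by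
  have h : (PH α d : Set (H α d)) = ⋂ x ∈ M α d, {h : H α d | h x = x} := by
    ext h
    simp only [Set.mem_iInter]
    rfl
  rw [h]
  refine isClosed_biInter fun x _ => isClosed_eq ?_ continuous_const
  have hi : Continuous fun h : H α d => (⟨h, h.continuous⟩ : C(X α d, X α d)) :=
    continuous_induced_dom
  exact (continuous_eval_const (F := C(X α d, X α d)) x).comp hi

theorem exists_perm_N (hd : 0 < d) : ∃ ρ : H α d →* Equiv.Perm (Fin d × ℕ),
    ∀ h i, h (blockPoint (model α d hd) (blockTopPoint α) i) =
      blockPoint (model α d hd) (blockTopPoint α) (ρ h i) := by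
  refine exists_induced_perm _ (blockPoint_injective _ _) fun h i => ?_
  obtain ⟨j, hj⟩ := (mem_N_iff_exists α d hd _).1
    (apply_mem_N h ((mem_N_iff_exists α d hd _).2 ⟨i, rfl⟩))
  exact ⟨j, hj.symm⟩

theorem exists_perm_M (hd : 0 < d) : ∃ μ : H α d →* Equiv.Perm (Fin d),
    ∀ h k, h (model α d hd (k, OnePoint.infty)) = model α d hd (μ h k, OnePoint.infty) := by
  refine exists_induced_perm (fun k => model α d hd (k, OnePoint.infty)) ?_ fun h k => ?_
  · intro k l hkl
    exact congrArg Prod.fst ((model α d hd).injective hkl)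
  · obtain ⟨l, hl⟩ := (mem_M_iff_exists α d hd _).1
      (apply_mem_M h ((mem_M_iff_exists α d hd _).2 ⟨k, rfl⟩))
    exact ⟨l, hl.symm⟩

theorem mem_F_iff (hd : 0 < d) {ρ : H α d →* Equiv.Perm (Fin d × ℕ)}
    (hρ : ∀ h i, h (blockPoint (model α d hd) (blockTopPoint α) i) =
      blockPoint (model α d hd) (blockTopPoint α) (ρ h i)) (h : H α d) :
    h ∈ F α d ↔ {i | ρ h i ≠ i}.Finite := by
  have hinj := blockPoint_injective (model α d hd) (blockTopPoint α)
  have he : {x ∈ N α d | h x ≠ x} =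
      blockPoint (model α d hd) (blockTopPoint α) '' {i | ρ h i ≠ i} := by
    ext x
    constructor
    · rintro ⟨hx, hhx⟩
      obtain ⟨i, rfl⟩ := (mem_N_iff_exists α d hd x).1 hx
      refine ⟨i, fun hi => hhx ?_, rfl⟩
      rw [hρ, hi]
    · rintro ⟨i, hi, rfl⟩
      refine ⟨(mem_N_iff_exists α d hd _).2 ⟨i, rfl⟩, fun hc => hi ?_⟩
      rw [hρ] at hc
      exact hinj hc
  change {x ∈ N α d | h x ≠ x}.Finite ↔ _
  rw [he, Set.finite_image_iff hinj.injOn]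

theorem Fbar_le_PH (hd : 0 < d) : Fbar α d ≤ PH α d := by
  obtain ⟨ρ, hρ⟩ := exists_perm_N (α := α) hd
  refine Subgroup.topologicalClosure_minimal _ (fun h hh => ?_) isClosed_PH
  rw [mem_F_iff hd hρ] at hh
  exact (mem_PH_iff hd h).2 (apply_infty_eq_of_finite _ _ hρ hh)

theorem mem_Fbar_iff (hd : 0 < d) {ρ : H α d →* Equiv.Perm (Fin d × ℕ)}
    (hρ : ∀ h i, h (blockPoint (model α d hd) (blockTopPoint α) i) =
      blockPoint (model α d hd) (blockTopPoint α) (ρ h i)) (h : H α d)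
    (hm : ρ h ∈ almostPreserving (Prod.fst : Fin d × ℕ → Fin d)) :
    h ∈ Fbar α d ↔ flux _ ⟨ρ h, hm⟩ = 1 := by
  have hF : (F α d : Set (H α d)) = {g | {i | ρ g i ≠ i}.Finite} :=
    Set.ext fun g => mem_F_iff hd hρ g
  have hmem : h ∈ Fbar α d ↔ h ∈ closure (F α d : Set (H α d)) := Iff.rfl
  rw [hmem]
  constructor
  · intro hh
    have hc : Continuous fun x : X α d => ((model α d hd).symm x).1 :=
      continuous_fst.comp (model α d hd).symm.continuous
    obtain ⟨g, hgF, hg⟩ :=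
      ((mem_closure_iff_frequently.1 hh).and_eventually (eventually_forall_apply_eq hc h)).exists
    have hfin : {i | ρ g i ≠ i}.Finite := (mem_F_iff hd hρ g).1 hgF
    have hgm : ρ g ∈ almostPreserving (Prod.fst : Fin d × ℕ → Fin d) :=
      perm_mem_almostPreserving _ _ hρ (apply_infty_eq_of_finite _ _ hρ hfin)
    rw [← flux_eq_of_forall _ _ hρ hgm hm hg]
    exact flux_eq_one_of_finite _ _ hfin
  · intro hh
    rw [hF]
    exact mem_closure_of_flux_eq_one _ _ hρ hm hh

theorem exists_PH_mulEquiv (α : Ordinal.{u}) (m : ℕ) [NeZero m] :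
    ∃ (φ : Multiplicative (Fin m → ℤ) →* MulAut (Fbar α (m + 1)))
      (e : (Fbar α (m + 1)) ⋊[φ] Multiplicative (Fin m → ℤ) ≃* PH α (m + 1)),
      ∀ f : Fbar α (m + 1), (e (SemidirectProduct.inl f) : H α (m + 1)) = f := by
  have hd : 0 < m + 1 := Nat.succ_pos m
  obtain ⟨ρ, hρ⟩ := exists_perm_N (α := α) hd
  have hmem : ∀ h : PH α (m + 1), ρ h ∈ almostPreserving (Prod.fst : Fin (m + 1) × ℕ → _) :=
    fun h => perm_mem_almostPreserving _ _ hρ ((mem_PH_iff hd _).1 h.2)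
  let r : PH α (m + 1) →* almostPreserving (Prod.fst : Fin (m + 1) × ℕ → Fin (m + 1)) :=
    (ρ.comp (PH α (m + 1)).subtype).codRestrict _ hmem
  -- Dropping coordinate `0` loses nothing on fluxes, whose coordinates sum to zero.
  let res : Multiplicative (Fin (m + 1) → ℤ) →* Multiplicative (Fin m → ℤ) :=
    AddMonoidHom.toMultiplicative (LinearMap.funLeft ℤ ℤ Fin.succ).toAddMonoidHom
  let s : Multiplicative (Fin m → ℤ) →* PH α (m + 1) :=
    ((blockHomeo (model α (m + 1) hd)).comp (shift m)).codRestrict _ fun v => by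
      rw [mem_PH_iff hd]
      intro k
      exact blockHomeo_apply _ _ _
  have hs : ∀ v, r (s v) = shift m v := fun v =>
    Subtype.ext (perm_blockHomeo _ _ hρ (shift m v))
  have hex : (Subgroup.inclusion (Fbar_le_PH (α := α) hd)).range =
      (res.comp ((flux _).comp r)).ker := by
    ext h
    have h1 : h ∈ (Subgroup.inclusion (Fbar_le_PH (α := α) hd)).range ↔ h.1 ∈ Fbar α (m + 1) := by
      constructor
      · rintro ⟨f, rfl⟩
        exact f.2
      · intro hf
        exact ⟨⟨h.1, hf⟩, rfl⟩
    rw [h1, mem_Fbar_iff hd hρ h.1 (hmem h), MonoidHom.mem_ker]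
    change flux _ (r h) = 1 ↔ res (flux _ (r h)) = 1
    refine ⟨fun hf => by rw [hf, map_one], fun hf => ?_⟩
    have hsucc : ∀ j : Fin m, (flux _ (r h)).toAdd j.succ = 0 := fun j =>
      congrFun (congrArg Multiplicative.toAdd hf) j
    have hsum := sum_flux _ (r h)
    rw [Fin.sum_univ_succ, Finset.sum_eq_zero (fun j _ => hsucc j), add_zero] at hsum
    apply Multiplicative.toAdd.injective
    funext k
    exact Fin.cases hsum hsucc k
  have hsec : ∀ v, res.comp ((flux _).comp r) (s v) = v := by
    intro v
    change res (flux _ (r (s v))) = v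
    rw [hs]
    apply Multiplicative.toAdd.injective
    funext j
    exact flux_shift m v j
  obtain ⟨φ, e, he⟩ := exists_semidirectProduct_mulEquiv _ _ s
    (Subgroup.inclusion_injective _) hex hsec
  exact ⟨φ, e, fun f => by rw [he]; rfl⟩

/-- Allowing any copy `K` of `PH` yields both the splitting over `PH` itself and the one over its
semidirect decomposition. -/
theorem exists_H_mulEquiv (hd : 0 < d) {K : Type*} [Group K] (i : K ≃* PH α d) :
    ∃ (ψ : Equiv.Perm (Fin d) →* MulAut K) (e : K ⋊[ψ] Equiv.Perm (Fin d) ≃* H α d),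
      ∀ p : K, e (SemidirectProduct.inl p) = i p := by
  obtain ⟨μ, hμ⟩ := exists_perm_M (α := α) hd
  have hinj : ∀ k l : Fin d, model α d hd (k, OnePoint.infty) = model α d hd (l, OnePoint.infty) →
      k = l := fun k l h => congrArg Prod.fst ((model α d hd).injective h)
  refine exists_semidirectProduct_mulEquiv ((PH α d).subtype.comp i.toMonoidHom) μ
    (columnHomeo (model α d hd)) (Subtype.val_injective.comp i.injective) ?_ fun π => ?_
  · ext h
    rw [MonoidHom.mem_ker]
    constructor
    · rintro ⟨p, rfl⟩
      ext1 k
      apply hinj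
      rw [← hμ]
      exact (mem_PH_iff hd _).1 (i p).2 k
    · intro hh
      have hP : h ∈ PH α d := (mem_PH_iff hd h).2 fun k => by rw [hμ, hh]; rfl
      exact ⟨i.symm ⟨h, hP⟩, congrArg Subtype.val (i.apply_symm_apply _)⟩
  · ext1 k
    apply hinj
    rw [← hμ, columnHomeo_apply]

end Main

end OrdinalHomeo

open OrdinalHomeo in
theorem mainTheorem6 (α : Ordinal.{u}) (d : ℕ) (hd : 1 < d) :
    ∃ (φ : Multiplicative (Fin (d - 1) → ℤ) →* MulAut (Fbar α d))
      (e₁ : (Fbar α d) ⋊[φ] Multiplicative (Fin (d - 1) → ℤ) ≃* PH α d),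
      (∀ f : Fbar α d, (e₁ (SemidirectProduct.inl f) : H α d) = f) ∧
      (∃ (ψ : Equiv.Perm (Fin d) →* MulAut (PH α d))
        (e₂ : (PH α d) ⋊[ψ] Equiv.Perm (Fin d) ≃* H α d),
        ∀ p : PH α d, e₂ (SemidirectProduct.inl p) = p) ∧
      (∃ (θ : Equiv.Perm (Fin d) →*
            MulAut ((Fbar α d) ⋊[φ] Multiplicative (Fin (d - 1) → ℤ)))
        (e₃ : ((Fbar α d) ⋊[φ] Multiplicative (Fin (d - 1) → ℤ)) ⋊[θ]
            Equiv.Perm (Fin d) ≃* H α d),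
        ∀ x : (Fbar α d) ⋊[φ] Multiplicative (Fin (d - 1) → ℤ),
          e₃ (SemidirectProduct.inl x) = e₁ x) := by
  obtain ⟨m, rfl⟩ : ∃ m, d = m + 1 := ⟨d - 1, by omega⟩
  have : NeZero m := ⟨by omega⟩
  obtain ⟨φ, e₁, he₁⟩ := exists_PH_mulEquiv α m
  exact ⟨φ, e₁, he₁, exists_H_mulEquiv m.succ_pos (MulEquiv.refl _),
    exists_H_mulEquiv m.succ_pos e₁⟩
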